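/- Let $H$ be an infinite-dimensional separable complex Hilbert space and let $T$ be a bounded linear operator on $H$. For a bounded operator $A$ on $H$ let $n(A)$ be the dimension of its kernel, $R(A)$ its range, $d(A)$ the codimension of $R(A)$, and $\operatorname{ind}A=n(A)-d(A)\in\mathbb Z\cup\{\pm\infty\}$ when $n(A)$ and $d(A)$ are not both infinite. Call $A$ *upper semi-Fredholm* if $n(A)<\infty$ and $R(A)$ is closed; *bounded below* if moreover $n(A)=0$; *Fredholm* if it is upper semi-Fredholm and $d(A)<\infty$; *Browder* if it is Fredholm and has finite ascent and finite descent (that is, $\ker A^k=\ker A^{k+1}$ for some $k\ge 0$ and $R(A^k)=R(A^{k+1})$ for some $k\ge 0$); and *consistent in invertibility* (CI) if for every bounded operator $S$ on $H$ the operators $SA$ and $AS$ are either both invertible or both not invertible. Let $\sigma(T)$ be the spectrum and $\sigma_p(T)$ the set of eigenvalues of $T$, and put - $\sigma_a(T)=\{\lambda\in\mathbb C: T-\lambda I \text{ is not bounded below}\}$, - $\sigma_{ea}(T)=\{\lambda\in\mathbb C: T-\lambda I\text{ is not upper semi-Fredholm, or }\operatorname{ind}(T-\lambda I)>0\}$,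 - $\sigma_b(T)=\{\lambda\in\mathbb C: T-\lambda I\text{ is not Browder}\}$, - $\sigma_{CI}(T)=\{\lambda\in\mathbb C: T-\lambda I\text{ is not CI}\}$, - $\sigma_G(T)=\{\lambda\in\mathbb C: R(T-\lambda I)\text{ is not closed}\}$, - $\Pi_G(T)=\sigma_G(T)\setminus\sigma_p(T)$ and $\Pi_a(T)=\sigma_a(T)\setminus\sigma_p(T)$. Write $\operatorname{acc}\sigma(T)$ and $\operatorname{iso}\sigma(T)$ for the sets of accumulation points and of isolated points of $\sigma(T)$, and $E(T)=\operatorname{iso}\sigma(T)\cap\sigma_p(T)$. The operator $T$ has property $(UW_E)$, written $T\in(UW_E)$, if $\sigma_a(T)\setminus\sigma_{ea}(T)=E(T)$. Then $$T\in(UW_E)\iff\sigma_b(T)=\sigma_{CI}(T)\cup\Pi_G(T)\cup[\operatorname{acc}\sigma(T)\cap\sigma_{ea}(T)],$$ and also $$T\in(UW_E)\iff\sigma_b(T)=\sigma_{CI}(T)\cup\Pi_a(T)\cup[\operatorname{acc}\sigma(T)\cap\sigma_{ea}(T)].$$ -/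

import Mathlib

/-!
Spectra of a bounded linear operator `T : H →L[ℂ] H` on a complex Hilbert space.
For `μ : ℂ`, the operator `T - μ I` is written `T - μ • 1`.
-/

noncomputable section

namespace UWE

variable {H : Type*} [NormedAddCommGroup H] [InnerProductSpace ℂ H]

/-- `n(T)`: the dimension of the kernel, in `ℕ ∪ {∞}`. -/
def nullity (T : H →L[ℂ] H) : ℕ∞ := Cardinal.toENat (Module.rank ℂ T.ker)

/-- `d(T)`: the (algebraic) codimension of the range, in `ℕ ∪ {∞}`. -/
def deficiency (T : H →L[ℂ] H) : ℕ∞ := Cardinal.toENat (Module.rank ℂ (H ⧸ T.range))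

/-- Upper semi-Fredholm operators: `n(T) < ∞` and `R(T)` is closed. -/
def IsUpperSemiFredholm (T : H →L[ℂ] H) : Prop :=
  nullity T < ⊤ ∧ IsClosed (T.range : Set H)

/-- Lower semi-Fredholm operators: `d(T) < ∞`. -/
def IsLowerSemiFredholm (T : H →L[ℂ] H) : Prop := deficiency T < ⊤

/-- `ind T = n(T) - d(T)` in `ℤ ∪ {±∞}`; it is used only for semi-Fredholm operators, for which
`n(T)` and `d(T)` are not both infinite. -/
def index (T : H →L[ℂ] H) : EReal :=
  ((nullity T : ENNReal) : EReal) - ((deficiency T : ENNReal) : EReal)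

/-- Bounded below operators: closed range and trivial kernel. -/
def IsBoundedBelow (T : H →L[ℂ] H) : Prop := IsUpperSemiFredholm T ∧ nullity T = 0

/-- The least `n` with `N(T^n) = N(T^(n+1))`, and `∞` if there is none. -/
def ascent (T : H →L[ℂ] H) : ℕ∞ :=
  ⨅ (n : ℕ) (_ : (T ^ n).ker = (T ^ (n + 1)).ker), (n : ℕ∞)

/-- The least `n` with `R(T^n) = R(T^(n+1))`, and `∞` if there is none. -/
def descent (T : H →L[ℂ] H) : ℕ∞ :=
  ⨅ (n : ℕ) (_ : (T ^ n).range = (T ^ (n + 1)).range), (n : ℕ∞)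

/-- Browder operators: Fredholm, of finite ascent and descent. -/
def IsBrowder (T : H →L[ℂ] H) : Prop :=
  T.IsFredholm ∧ ascent T < ⊤ ∧ descent T < ⊤

/-- `T` is consistent in invertibility: for every `S`, the operators `S T` and `T S` are either
both invertible or both not invertible (in the algebra of bounded operators). -/
def IsCI (T : H →L[ℂ] H) : Prop := ∀ S : H →L[ℂ] H, IsUnit (S * T) ↔ IsUnit (T * S)

/-- The point spectrum: the eigenvalues of `T`. -/
def pointSpectrum (T : H →L[ℂ] H) : Set ℂ :=
  {μ | Module.End.HasEigenvalue (T : H →ₗ[ℂ] H) μ}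

/-- The approximate point spectrum. -/
def approxSpectrum (T : H →L[ℂ] H) : Set ℂ := {μ | ¬ IsBoundedBelow (T - μ • 1)}

/-- The essential approximate point spectrum. -/
def essApproxSpectrum (T : H →L[ℂ] H) : Set ℂ :=
  {μ | ¬ IsUpperSemiFredholm (T - μ • 1) ∨ 0 < index (T - μ • 1)}

/-- The Browder spectrum. -/
def browderSpectrum (T : H →L[ℂ] H) : Set ℂ := {μ | ¬ IsBrowder (T - μ • 1)}

/-- The CI spectrum. -/
def ciSpectrum (T : H →L[ℂ] H) : Set ℂ := {μ | ¬ IsCI (T - μ • 1)}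

/-- The Goldberg spectrum: the `μ` for which `R(T - μ I)` is not closed. -/
def goldbergSpectrum (T : H →L[ℂ] H) : Set ℂ :=
  {μ | ¬ IsClosed ((T - μ • 1).range : Set H)}

/-- `Π_G(T) = σ_G(T) \ σ_p(T)`. -/
def piG (T : H →L[ℂ] H) : Set ℂ := goldbergSpectrum T \ pointSpectrum T

/-- `Π_a(T) = σ_a(T) \ σ_p(T)`. -/
def piA (T : H →L[ℂ] H) : Set ℂ := approxSpectrum T \ pointSpectrum T

/-- `E(T) = iso σ(T) ∩ σ_p(T)`: the eigenvalues that are isolated points of the spectrum.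
Mathlib's `derivedSet A` is the set of accumulation points of `A`. -/
def isolatedEigenvalues (T : H →L[ℂ] H) : Set ℂ :=
  (spectrum ℂ T \ derivedSet (spectrum ℂ T)) ∩ pointSpectrum T

/-- Property `(UW_E)`: `σ_a(T) \ σ_ea(T) = E(T)`. -/
def PropertyUWE (T : H →L[ℂ] H) : Prop :=
  approxSpectrum T \ essApproxSpectrum T = isolatedEigenvalues T

/-- Mathlib's Fredholm operators are those that are upper and lower semi-Fredholm. -/
theorem isFredholm_iff [CompleteSpace H] (T : H →L[ℂ] H) :
    T.IsFredholm ↔ IsUpperSemiFredholm T ∧ IsLowerSemiFredholm T := by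
  have hk : nullity T < ⊤ ↔ FiniteDimensional ℂ T.ker := by
    rw [nullity, Cardinal.toENat_lt_top, Module.rank_lt_aleph0_iff]
  have hr : deficiency T < ⊤ ↔ FiniteDimensional ℂ (H ⧸ T.range) := by
    rw [deficiency, Cardinal.toENat_lt_top, Module.rank_lt_aleph0_iff]
  rw [IsUpperSemiFredholm, IsLowerSemiFredholm, hk, hr]
  constructor
  · intro h
    exact ⟨⟨h.finite_ker, h.isClosed_range⟩, h.finite_coker⟩
  · rintro ⟨⟨h1, h2⟩, h3⟩
    have := h1
    have : CompleteSpace T.range := h2.completeSpace_coe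
    have hs : Function.Surjective T.rangeRestrict := fun ⟨_, x, hx⟩ => ⟨x, Subtype.ext hx⟩
    have hq : Topology.IsQuotientMap T.rangeRestrict := T.rangeRestrict.isQuotientMap hs
    exact ⟨hq, h2, h1, h3, Submodule.ClosedComplemented.of_finiteDimensional _⟩

end UWE

end

open Filter Topology

namespace UWE

/-! ### Perturbation of one-sided inverses. -/

section Restriction

variable {E : Type*} [NormedAddCommGroup E] [NormedSpace ℂ E]

/-! Both equivalences hold point by point. Put `A = T - μ • 1`. At a given `μ`, property `(UW_E)`
fails exactly when `μ` is an eigenvalue lying in exactly one of `acc σ(T)` and `σ_ea(T)`, and the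
formula for `σ_b(T)` fails at the same points. This is propositional logic from four facts: (1) a
Browder `A` is CI with closed range and index 0, and `μ` is not in `acc σ(T)`; (2) a CI operator
that is bounded below is invertible; (3) if `A` is neither CI nor injective, it is surjective, so
its index is positive, and `μ` is an accumulation point of `σ(T)`; (4) if `μ` is in neither
`σ_ea(T)` nor `acc σ(T)`, then `A` is Browder (`IsUpperSemiFredholm.isBrowder_of_frequently`). Facts
(3) and (4) rest on one principle: a one-sided invertible element that is a limit of invertible `a -
μ • 1` is invertible. The second formula is the first one, since an injective operator is bounded
below exactly when its range is closed, whence `piA_eq_piG`. -/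

theorem isUnit_sub_smul_eventually {R : Type*} [NormedRing R] [NormedAlgebra ℂ R]
    [CompleteSpace R] {a : R} (ha : IsUnit a) (b : R) : ∀ᶠ μ : ℂ in 𝓝 0, IsUnit (a - μ • b) := by
  have hc : ContinuousAt (fun μ : ℂ => a - μ • b) 0 := by fun_prop
  have hn : {x : R | IsUnit x} ∈ 𝓝 (a - (0 : ℂ) • b) := by
    simpa using Units.isOpen.mem_nhds ha
  exact hc hn

/-- For small `μ`, `b * (a - μ • 1) = 1 - μ • b` is invertible. If `a - μ • 1` is invertible too,
then so is `b`, and hence `a`. -/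
theorem isUnit_of_mul_eq_one_of_frequently {R : Type*} [NormedRing R] [NormedAlgebra ℂ R]
    [CompleteSpace R] {a b : R} (hba : b * a = 1)
    (h : ∃ᶠ μ : ℂ in 𝓝 0, IsUnit (a - μ • 1)) : IsUnit a := by
  obtain ⟨μ, hμ, hμ'⟩ := (h.and_eventually (isUnit_sub_smul_eventually isUnit_one b)).exists
  have hb : IsUnit b := by
    have : b * (a - μ • 1) = 1 - μ • b := by rw [mul_sub, hba]; simp
    rw [← this] at hμ'
    simpa [mul_assoc] using hμ'.mul hμ.unit⁻¹.isUnit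
  have : IsUnit (b * a) := hba ▸ isUnit_one
  simpa [← mul_assoc] using hb.unit⁻¹.isUnit.mul this

theorem isUnit_of_mul_eq_one_of_frequently' {R : Type*} [NormedRing R] [NormedAlgebra ℂ R]
    [CompleteSpace R] {a b : R} (hab : a * b = 1)
    (h : ∃ᶠ μ : ℂ in 𝓝 0, IsUnit (a - μ • 1)) : IsUnit a := by
  obtain ⟨μ, hμ, hμ'⟩ := (h.and_eventually (isUnit_sub_smul_eventually isUnit_one b)).exists
  have hb : IsUnit b := by
    have : (a - μ • 1) * b = 1 - μ • b := by rw [sub_mul, hab]; simp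
    rw [← this] at hμ'
    simpa [← mul_assoc] using hμ.unit⁻¹.isUnit.mul hμ'
  have : IsUnit (a * b) := hab ▸ isUnit_one
  simpa [mul_assoc] using this.mul hb.unit⁻¹.isUnit

/-! ### Invariant subspaces, and kernels and ranges of powers. -/

theorem isUnit_restrict_sub_smul [CompleteSpace E] {A : E →L[ℂ] E} {M : Submodule ℂ E} [CompleteSpace M]
    (hM : ∀ x ∈ M, A x ∈ M) {μ : ℂ} (hμ : IsUnit (A - μ • 1))
    (hM' : ∀ x, (A - μ • 1) x ∈ M → x ∈ M) : IsUnit (A.restrict hM - μ • 1) := by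
  rw [ContinuousLinearMap.isUnit_iff_bijective] at hμ ⊢
  have key : ∀ x : M, (((A.restrict hM - μ • 1) x : M) : E) = (A - μ • 1) x := fun x => by simp
  constructor
  · intro x y hxy
    exact Subtype.ext (hμ.1 (by rw [← key, ← key, hxy]))
  · intro y
    obtain ⟨x, hx⟩ := hμ.2 y
    exact ⟨⟨x, hM' x (hx ▸ y.2)⟩, Subtype.ext (by rw [key]; exact hx)⟩

theorem pow_add_apply' (A : E →L[ℂ] E) (m n : ℕ) (x : E) :
    (A ^ (m + n)) x = (A ^ m) ((A ^ n) x) := by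
  rw [pow_add]; rfl

theorem pow_succ_apply_left (A : E →L[ℂ] E) (n : ℕ) (x : E) :
    (A ^ (n + 1)) x = A ((A ^ n) x) := by
  rw [pow_succ']; rfl

theorem pow_succ_apply_right (A : E →L[ℂ] E) (n : ℕ) (x : E) :
    (A ^ (n + 1)) x = (A ^ n) (A x) := by
  rw [pow_succ]; rfl

theorem mem_ker_iff {A : E →L[ℂ] E} {x : E} : x ∈ A.ker ↔ A x = 0 := Iff.rfl

theorem commute_pow_apply (A : E →L[ℂ] E) (μ : ℂ) (n : ℕ) (x : E) :
    (A - μ • 1) ((A ^ n) x) = (A ^ n) ((A - μ • 1) x) := by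
  have h : Commute (A - μ • 1) (A ^ n) :=
    ((Commute.refl A).pow_right n).sub_left (((Commute.one_left _).smul_left μ))
  exact congrArg (fun f : E →L[ℂ] E => f x) h.eq

theorem mem_range_pow_of_sub_smul [CompleteSpace E] {A : E →L[ℂ] E} {μ : ℂ} (hμ : IsUnit (A - μ • 1)) (n : ℕ)
    {x : E} (hx : (A - μ • 1) x ∈ (A ^ n).range) : x ∈ (A ^ n).range := by
  rw [ContinuousLinearMap.isUnit_iff_bijective] at hμ
  obtain ⟨y, hy⟩ := hx
  obtain ⟨z, rfl⟩ := hμ.2 y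
  refine ⟨z, hμ.1 ?_⟩
  rw [← hy]
  exact commute_pow_apply A μ n z

theorem map_mem_range_pow (A : E →L[ℂ] E) (n : ℕ) {x : E} (hx : x ∈ (A ^ n).range) :
    A x ∈ (A ^ n).range := by
  obtain ⟨y, rfl⟩ := hx
  exact ⟨A y, (pow_succ_apply_right A n y).symm.trans (pow_succ_apply_left A n y)⟩

theorem map_range_pow (A : E →L[ℂ] E) (n : ℕ) :
    (A ^ n).range.map (A : E →ₗ[ℂ] E) = (A ^ (n + 1)).range := by
  ext x
  constructor
  · rintro ⟨_, ⟨y, rfl⟩, rfl⟩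
    exact ⟨y, pow_succ_apply_left A n y⟩
  · rintro ⟨y, rfl⟩
    exact ⟨(A ^ n) y, ⟨y, rfl⟩, (pow_succ_apply_left A n y).symm⟩

theorem range_pow_antitone (A : E →L[ℂ] E) : Antitone fun n : ℕ => (A ^ n).range := by
  refine antitone_nat_of_succ_le fun n => ?_
  rintro _ ⟨x, rfl⟩
  exact ⟨A x, (pow_succ_apply_right A n x).symm⟩

theorem ker_pow_monotone (A : E →L[ℂ] E) : Monotone fun n : ℕ => (A ^ n).ker := by
  refine monotone_nat_of_le_succ fun n x hx => ?_
  rw [mem_ker_iff] at hx ⊢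
  rw [pow_succ_apply_left, hx, map_zero]

theorem ker_pow_add_eq {A : E →L[ℂ] E} {n : ℕ} (h : (A ^ n).ker = (A ^ (n + 1)).ker) (k : ℕ) :
    (A ^ (n + k)).ker = (A ^ n).ker := by
  induction k with
  | zero => rfl
  | succ k ih =>
    rw [← ih]
    refine le_antisymm (fun x hx => ?_) (ker_pow_monotone A (by omega))
    have h1 : (A ^ k) x ∈ (A ^ (n + 1)).ker := by
      rwa [mem_ker_iff, ← pow_add_apply', show n + 1 + k = n + (k + 1) by ring]
    rw [← h] at h1
    rwa [mem_ker_iff, pow_add_apply']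

theorem range_pow_add_eq {A : E →L[ℂ] E} {n : ℕ} (h : (A ^ n).range = (A ^ (n + 1)).range)
    (k : ℕ) : (A ^ (n + k)).range = (A ^ n).range := by
  induction k with
  | zero => rfl
  | succ k ih =>
    rw [← add_assoc, ← map_range_pow, ih, map_range_pow, h]

theorem isClosed_map_of_finiteDimensional_ker [CompleteSpace E] {A : E →L[ℂ] E} [FiniteDimensional ℂ A.ker]
    (hA : IsClosed (A.range : Set E)) {M : Submodule ℂ E} (hM : IsClosed (M : Set E)) :
    IsClosed (M.map (A : E →ₗ[ℂ] E) : Set E) := by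
  have : CompleteSpace A.range := hA.completeSpace_coe
  have hs : Function.Surjective A.rangeRestrict := fun ⟨_, x, hx⟩ => ⟨x, Subtype.ext hx⟩
  have hq : Topology.IsQuotientMap A.rangeRestrict := A.rangeRestrict.isQuotientMap hs
  have h1 : IsClosed (A.rangeRestrict '' (M : Set E)) := by
    rw [← hq.isClosed_preimage]
    -- The saturation of `M` is `M ⊔ A.ker`, closed because the kernel is finite-dimensional.
    have : A.rangeRestrict ⁻¹' (A.rangeRestrict '' (M : Set E)) = (M ⊔ A.ker : Submodule ℂ E) := by
      ext x
      simp only [Set.mem_preimage, Set.mem_image, SetLike.mem_coe, Submodule.mem_sup]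
      constructor
      · rintro ⟨y, hy, hyx⟩
        have hyx' : A y = A x := congrArg Subtype.val hyx
        exact ⟨y, hy, x - y, by simp [hyx'], by simp⟩
      · rintro ⟨y, hy, z, hz, rfl⟩
        have hz' : A z = 0 := hz
        exact ⟨y, hy, Subtype.ext (by simp [hz'])⟩
    rw [this]
    exact Submodule.isClosed_sup_finiteDimensional _ _ hM
  convert hA.isClosedEmbedding_subtypeVal.isClosedMap _ h1 using 1
  rw [Set.image_image]
  rfl

theorem isClosed_range_pow [CompleteSpace E] {A : E →L[ℂ] E} [FiniteDimensional ℂ A.ker]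
    (hA : IsClosed (A.range : Set E)) (n : ℕ) : IsClosed ((A ^ n).range : Set E) := by
  induction n with
  | zero =>
    have : ((A ^ 0).range : Set E) = Set.univ := by
      ext x; simp
    rw [this]; exact isClosed_univ
  | succ n ih =>
    rw [← map_range_pow]
    exact isClosed_map_of_finiteDimensional_ker hA ih

/-- A descending chain of subspaces of a finite-dimensional space stabilizes. -/
theorem exists_forall_ker_inf_range_pow_eq (A : E →L[ℂ] E) [FiniteDimensional ℂ A.ker] :
    ∃ n, ∀ m, n ≤ m → A.ker ⊓ (A ^ n).range = A.ker ⊓ (A ^ m).range := by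
  let f : ℕ →o (Submodule ℂ A.ker)ᵒᵈ :=
    ⟨fun n => OrderDual.toDual ((A ^ n).range.comap A.ker.subtype), fun m n hmn =>
      Submodule.comap_mono (range_pow_antitone A hmn)⟩
  obtain ⟨n, hn⟩ := IsArtinian.monotone_stabilizes f
  refine ⟨n, fun m hm => ?_⟩
  have := congrArg (fun p : (Submodule ℂ A.ker)ᵒᵈ =>
    (OrderDual.ofDual p).map A.ker.subtype) (hn m hm)
  simpa [f, Submodule.map_comap_subtype] using this

/-- Fitting decomposition at an exponent where both chains have stabilized. -/
theorem isCompl_ker_range_pow {A : E →L[ℂ] E} {p : ℕ} (hk : (A ^ p).ker = (A ^ (p + 1)).ker)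
    (hr : (A ^ p).range = (A ^ (p + 1)).range) : IsCompl (A ^ p).ker (A ^ p).range := by
  constructor
  · rw [Submodule.disjoint_def]
    rintro _ hx ⟨y, rfl⟩
    have : y ∈ (A ^ (p + p)).ker := by
      rw [mem_ker_iff, pow_add_apply']; exact hx
    rw [ker_pow_add_eq hk] at this
    exact this
  · rw [codisjoint_iff, eq_top_iff]
    intro x _
    have : (A ^ p) x ∈ (A ^ (p + p)).range := by
      rw [range_pow_add_eq hr]; exact ⟨x, rfl⟩
    obtain ⟨y, hy⟩ := this
    have hy' : (A ^ p) ((A ^ p) y) = (A ^ p) x := (pow_add_apply' A p p y).symm.trans hy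
    rw [Submodule.mem_sup]
    exact ⟨x - (A ^ p) y, by rw [mem_ker_iff, map_sub, hy', sub_self], (A ^ p) y, ⟨y, rfl⟩, by simp⟩

theorem bijective_restrict_range_pow {A : E →L[ℂ] E} {p : ℕ}
    (hk : (A ^ p).ker = (A ^ (p + 1)).ker) (hr : (A ^ p).range = (A ^ (p + 1)).range) :
    Function.Bijective (A.restrict fun _ => map_mem_range_pow A p) := by
  constructor
  · rw [injective_iff_map_eq_zero]
    rintro ⟨_, y, rfl⟩ hx
    have h0 : A ((A ^ p) y) = 0 := congrArg Subtype.val hx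
    have : y ∈ (A ^ (p + 1)).ker := by rwa [mem_ker_iff, pow_succ_apply_left]
    rw [← hk] at this
    exact Subtype.ext this
  · rintro ⟨x, hx⟩
    have hx' := hx
    rw [hr, ← map_range_pow] at hx'
    obtain ⟨y, hy, hyx⟩ := hx'
    exact ⟨⟨y, hy⟩, Subtype.ext hyx⟩

theorem exists_common_stable_pow {A : E →L[ℂ] E} {m n : ℕ}
    (hk : (A ^ m).ker = (A ^ (m + 1)).ker) (hr : (A ^ n).range = (A ^ (n + 1)).range) :
    (A ^ (m + n)).ker = (A ^ (m + n + 1)).ker ∧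
      (A ^ (m + n)).range = (A ^ (m + n + 1)).range := by
  refine ⟨?_, ?_⟩
  · rw [ker_pow_add_eq hk, add_assoc, ker_pow_add_eq hk]
  · rw [add_comm m n, range_pow_add_eq hr, add_assoc, range_pow_add_eq hr]

end Restriction

/-! ### Numerical invariants and spectra in elementary terms. -/

section Hilbert

variable {H : Type*} [NormedAddCommGroup H] [InnerProductSpace ℂ H]

theorem nullity_lt_top_iff {A : H →L[ℂ] H} : nullity A < ⊤ ↔ FiniteDimensional ℂ A.ker := by
  rw [nullity, Cardinal.toENat_lt_top, Module.rank_lt_aleph0_iff]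

theorem nullity_eq_zero_iff {A : H →L[ℂ] H} : nullity A = 0 ↔ Function.Injective A := by
  rw [nullity, Cardinal.toENat_eq_zero, Submodule.rank_eq_zero]
  exact LinearMap.ker_eq_bot

theorem deficiency_eq_zero {A : H →L[ℂ] H} (h : Function.Surjective A) : deficiency A = 0 := by
  have : A.range = ⊤ := LinearMap.range_eq_top.2 h
  rw [deficiency, this]
  simp

theorem ascent_lt_top_iff {A : H →L[ℂ] H} :
    ascent A < ⊤ ↔ ∃ n : ℕ, (A ^ n).ker = (A ^ (n + 1)).ker := by
  simp [ascent, iInf_lt_top]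

theorem descent_lt_top_iff {A : H →L[ℂ] H} :
    descent A < ⊤ ↔ ∃ n : ℕ, (A ^ n).range = (A ^ (n + 1)).range := by
  simp [descent, iInf_lt_top]

theorem isBoundedBelow_iff {A : H →L[ℂ] H} :
    IsBoundedBelow A ↔ Function.Injective A ∧ IsClosed (A.range : Set H) := by
  rw [IsBoundedBelow, IsUpperSemiFredholm, nullity_eq_zero_iff]
  refine ⟨fun h => ⟨h.2, h.1.2⟩, fun h => ⟨⟨?_, h.2⟩, h.1⟩⟩
  rw [nullity_eq_zero_iff.2 h.1]
  exact ENat.top_pos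

theorem mem_pointSpectrum_iff {T : H →L[ℂ] H} {μ : ℂ} :
    μ ∈ pointSpectrum T ↔ ¬ Function.Injective (T - μ • 1 : H →L[ℂ] H) := by
  rw [pointSpectrum, Set.mem_ofPred_eq, Module.End.hasEigenvalue_iff, Module.End.eigenspace_def,
    Ne, LinearMap.ker_eq_bot]
  rfl

theorem mem_spectrum_iff {T : H →L[ℂ] H} {μ : ℂ} :
    μ ∈ spectrum ℂ T ↔ ¬ IsUnit (T - μ • 1 : H →L[ℂ] H) := by
  rw [spectrum.mem_iff, Algebra.algebraMap_eq_smul_one, ← IsUnit.neg_iff, neg_sub]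

theorem notMem_derivedSet_spectrum_iff {T : H →L[ℂ] H} {μ : ℂ} :
    μ ∉ derivedSet (spectrum ℂ T) ↔ ∀ᶠ ν : ℂ in 𝓝[≠] 0, IsUnit (T - μ • 1 - ν • 1) := by
  rw [mem_derivedSet, accPt_iff_frequently_nhdsNE, not_frequently]
  have h : 𝓝[≠] μ = map (fun ν => μ + ν) (𝓝[≠] 0) := by simp
  rw [h, eventually_map]
  simp only [mem_spectrum_iff, not_not, add_smul, sub_sub]

theorem finiteDimensional_ker_pow {A : H →L[ℂ] H} [FiniteDimensional ℂ A.ker] (n : ℕ) :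
    FiniteDimensional ℂ (A ^ n).ker := by
  rw [← Submodule.fg_iff_finiteDimensional]
  induction n with
  | zero =>
    have : (A ^ 0).ker = ⊥ := LinearMap.ker_eq_bot.2 fun x y h => by simpa using h
    rw [this]
    exact Submodule.fg_bot
  | succ n ih =>
    have := (Submodule.fg_iff_finiteDimensional _).1 ih
    refine Submodule.fg_of_fg_map_of_fg_inf_ker (A : H →ₗ[ℂ] H) ?_ ?_
    · have hle : (A ^ (n + 1)).ker.map (A : H →ₗ[ℂ] H) ≤ (A ^ n).ker := by
        rintro _ ⟨x, hx, rfl⟩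
        exact (pow_succ_apply_right A n x).symm.trans hx
      exact (Submodule.fg_iff_finiteDimensional _).2 (Submodule.finiteDimensional_of_le hle)
    · exact (Submodule.fg_iff_finiteDimensional _).2 (Submodule.finiteDimensional_of_le inf_le_right)

/-- By the Fitting decomposition everything happens on the finite-dimensional `N`: `H ⧸ A.range` is
the cokernel of `A` on `N`, and rank-nullity applies to `f` and `g`. -/
theorem nullity_eq_deficiency {A : H →L[ℂ] H} [FiniteDimensional ℂ A.ker] {p : ℕ}
    (hk : (A ^ p).ker = (A ^ (p + 1)).ker) (hr : (A ^ p).range = (A ^ (p + 1)).range) :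
    nullity A = deficiency A := by
  have hc := isCompl_ker_range_pow hk hr
  have hfd : FiniteDimensional ℂ (A ^ p).ker := finiteDimensional_ker_pow p
  set N := (A ^ p).ker with hN
  have hAN : ∀ x ∈ N, (A : H →ₗ[ℂ] H) x ∈ N := fun x hx => by
    rw [hk]
    rw [hN, mem_ker_iff] at hx
    change (A ^ (p + 1)) (A x) = 0
    rw [← pow_succ_apply_right, pow_succ_apply_left, pow_succ_apply_left, hx, map_zero, map_zero]
  have hrange : (A ^ p).range ≤ A.range := by
    rw [hr]
    simpa using range_pow_antitone A (show 1 ≤ p + 1 by omega)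
  have hker : A.ker ≤ N := by
    rw [hk]
    simpa using ker_pow_monotone A (show 1 ≤ p + 1 by omega)
  let f : N →ₗ[ℂ] N := (A : H →ₗ[ℂ] H).restrict hAN
  let g : N →ₗ[ℂ] H ⧸ A.range := A.range.mkQ ∘ₗ N.subtype
  have hg : Function.Surjective g := by
    intro y
    obtain ⟨x, rfl⟩ := A.range.mkQ_surjective y
    obtain ⟨u, hu, v, hv, rfl⟩ := Submodule.mem_sup.1 (hc.sup_eq_top ▸ Submodule.mem_top (x := x))
    refine ⟨⟨u, hu⟩, ?_⟩
    have : A.range.mkQ v = 0 := by simpa using hrange hv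
    rw [map_add, this, add_zero]
    rfl
  have hgf : g.ker = f.range := by
    ext ⟨x, hx⟩
    have h1 : (⟨x, hx⟩ : N) ∈ g.ker ↔ x ∈ A.range := by simp [g]
    rw [h1]
    constructor
    · rintro ⟨y, rfl⟩
      obtain ⟨u, hu, v, hv, rfl⟩ :=
        Submodule.mem_sup.1 (hc.sup_eq_top ▸ Submodule.mem_top (x := y))
      refine ⟨⟨u, hu⟩, Subtype.ext ?_⟩
      have hAv : (A : H →ₗ[ℂ] H) v ∈ N := by
        have := N.sub_mem hx (hAN u hu)
        rwa [map_add, add_sub_cancel_left] at this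
      have := (Submodule.disjoint_def.1 hc.disjoint) _ hAv (map_mem_range_pow A p hv)
      change (A : H →ₗ[ℂ] H) u = (A : H →ₗ[ℂ] H) (u + v)
      rw [map_add, this, add_zero]
    · rintro ⟨y, hy⟩
      exact ⟨y, congrArg Subtype.val hy⟩
  have hfk : f.ker = A.ker.comap N.subtype := by
    ext x
    simp [f, LinearMap.restrict_apply, Subtype.ext_iff]
  have hfkd : Module.finrank ℂ f.ker = Module.finrank ℂ A.ker := by
    rw [hfk]
    exact (Submodule.comapSubtypeEquivOfLe hker).finrank_eq
  have e1 := f.finrank_range_add_finrank_ker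
  have e2 := g.finrank_range_add_finrank_ker
  have hq : FiniteDimensional ℂ (H ⧸ A.range) := Module.Finite.of_surjective g hg
  rw [hgf, LinearMap.range_eq_top.2 hg, finrank_top] at e2
  have : Module.finrank ℂ A.ker = Module.finrank ℂ (H ⧸ A.range) := by omega
  rw [nullity, deficiency, ← Module.finrank_eq_rank, ← Module.finrank_eq_rank, this]

theorem index_pos_of_surjective {A : H →L[ℂ] H} (hs : Function.Surjective A)
    (hi : ¬ Function.Injective A) : 0 < index A := by
  have : 0 < nullity A := pos_iff_ne_zero.2 fun h => hi (nullity_eq_zero_iff.1 h)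
  rw [index, deficiency_eq_zero hs]
  have h' : (0 : ENNReal) < nullity A := by simpa using ENat.toENNReal_lt.2 this
  simpa using h'

theorem IsBrowder.injective_iff_surjective {A : H →L[ℂ] H} (h : IsBrowder A) :
    Function.Injective A ↔ Function.Surjective A := by
  obtain ⟨-, ha, hd⟩ := h
  rw [ascent_lt_top_iff] at ha
  rw [descent_lt_top_iff] at hd
  have hp : ∀ n : ℕ, ⇑(A ^ n) = A^[n] := fun n => by ext; simp
  constructor
  · obtain ⟨n, hn⟩ := hd
    intro hi y
    have : (A ^ n) y ∈ (A ^ (n + 1)).range := hn ▸ ⟨y, rfl⟩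
    obtain ⟨x, hx⟩ := this
    refine ⟨x, ?_⟩
    have hin : Function.Injective (A ^ n) := hp n ▸ hi.iterate n
    exact hin ((pow_succ_apply_right A n x).symm.trans hx)
  · obtain ⟨n, hn⟩ := ha
    intro hs
    rw [injective_iff_map_eq_zero]
    intro x hx
    have hsn : Function.Surjective (A ^ n) := hp n ▸ hs.iterate n
    obtain ⟨y, rfl⟩ := hsn x
    have : y ∈ (A ^ (n + 1)).ker := by rwa [mem_ker_iff, pow_succ_apply_left]
    rwa [← hn] at this

variable [CompleteSpace H]

/-! ### One-sided inverses from orthogonal complements. -/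

theorem exists_mul_eq_one_of_injective {A : H →L[ℂ] H} (hi : Function.Injective A)
    (hc : IsClosed (A.range : Set H)) : ∃ B : H →L[ℂ] H, B * A = 1 := by
  have : CompleteSpace A.range := hc.completeSpace_coe
  obtain ⟨B, hB⟩ :=
    ContinuousLinearMap.HasLeftInverse.of_injective_of_isClosed_range_of_closedComplement_range
      hi hc ⟨A.range.orthogonalProjectionOnto, fun x => by simp⟩
  exact ⟨B, ContinuousLinearMap.ext hB⟩

theorem exists_mul_eq_one_of_surjective {A : H →L[ℂ] H} (hs : Function.Surjective A) :
    ∃ B : H →L[ℂ] H, A * B = 1 := by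
  have hk : IsClosed (A.ker : Set H) := A.isClosed_ker
  have : CompleteSpace A.ker := hk.completeSpace_coe
  let f : A.kerᗮ →L[ℂ] H := A.comp A.kerᗮ.subtypeL
  have hf1 : f.ker = ⊥ := by
    refine LinearMap.ker_eq_bot'.2 fun x hx => ?_
    have : (x : H) ∈ A.ker ⊓ A.kerᗮ := ⟨hx, x.2⟩
    rw [Submodule.inf_orthogonal_eq_bot] at this
    exact Subtype.ext this
  have hf2 : f.range = ⊤ := by
    refine LinearMap.range_eq_top.2 fun y => ?_
    obtain ⟨x, rfl⟩ := hs y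
    obtain ⟨u, hu, v, hv, rfl⟩ := Submodule.mem_sup.1
      (Submodule.sup_orthogonal_of_hasOrthogonalProjection (K := A.ker) ▸
        Submodule.mem_top (x := x))
    exact ⟨⟨v, hv⟩, by rw [mem_ker_iff] at hu; rw [map_add, hu, zero_add]; rfl⟩
  let e := ContinuousLinearEquiv.ofBijective f hf1 hf2
  refine ⟨A.kerᗮ.subtypeL.comp (e.symm : H →L[ℂ] A.kerᗮ), ContinuousLinearMap.ext fun y => ?_⟩
  exact e.apply_symm_apply y

/-! ### Browder operators and isolated points of the spectrum. -/

theorem isBrowder_of_isUnit {A : H →L[ℂ] H} (hA : IsUnit A) : IsBrowder A := by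
  have hb := ContinuousLinearMap.isUnit_iff_bijective.1 hA
  have hr : A.range = ⊤ := LinearMap.range_eq_top.2 hb.2
  have hk : A.ker = ⊥ := LinearMap.ker_eq_bot.2 hb.1
  refine ⟨(isFredholm_iff A).2 ⟨⟨?_, ?_⟩, ?_⟩, ascent_lt_top_iff.2 ⟨0, ?_⟩,
    descent_lt_top_iff.2 ⟨0, ?_⟩⟩
  · rw [nullity_eq_zero_iff.2 hb.1]; exact ENat.top_pos
  · rw [hr]; exact isClosed_univ
  · rw [IsLowerSemiFredholm, deficiency_eq_zero hb.2]; exact ENat.top_pos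
  · rw [zero_add, pow_one, hk]
    exact LinearMap.ker_eq_bot.2 fun x y h => by simpa using h
  · rw [zero_add, pow_one, hr]
    exact LinearMap.range_eq_top.2 fun x => ⟨x, by simp⟩

/-- On the intersection `M` of the ranges of powers, `A` is onto, hence invertible by perturbation.
As `A.ker ⊓ (A ^ n).range` lies in `M`, it is zero, which stabilizes the kernels. So `A` is bounded
below on `(A ^ n).range`, hence invertible there, which stabilizes the ranges. -/
theorem IsUpperSemiFredholm.isBrowder_of_frequently {A : H →L[ℂ] H} (hA : IsUpperSemiFredholm A)
    (h : ∃ᶠ μ : ℂ in 𝓝 0, IsUnit (A - μ • 1)) : IsBrowder A := by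
  obtain ⟨hfin, hcl⟩ := hA
  have := nullity_lt_top_iff.1 hfin
  have hclp := isClosed_range_pow hcl
  obtain ⟨n, hn⟩ := exists_forall_ker_inf_range_pow_eq A
  -- `A` restricts to a bijection of the intersection of the ranges of its powers.
  set M : Submodule ℂ H := ⨅ k, (A ^ k).range with hMdef
  have hMcl : IsClosed (M : Set H) := by
    rw [hMdef, Submodule.coe_iInf]
    exact isClosed_iInter hclp
  have : CompleteSpace M := hMcl.completeSpace_coe
  have hM : ∀ x ∈ M, A x ∈ M := fun x hx => by
    rw [hMdef, Submodule.mem_iInf] at hx ⊢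
    exact fun k => map_mem_range_pow A k (hx k)
  have hMs : Function.Surjective (A.restrict hM) := by
    rintro ⟨y, hy⟩
    have hy' := (Submodule.mem_iInf _).1 hy
    have hpre : ∀ k, ∃ u ∈ (A ^ k).range, A u = y := fun k => by
      have := hy' (k + 1)
      rw [← map_range_pow] at this
      exact this
    -- One preimage serves all `k`: it differs from a preimage deeper in the chain by an element of
    -- `A.ker ⊓ (A ^ n).range`, which lies in every range.
    obtain ⟨u, hu, hAu⟩ := hpre n
    have huM : u ∈ M := by
      rw [hMdef, Submodule.mem_iInf]
      intro k
      obtain ⟨v, hv, hAv⟩ := hpre (max n k)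
      have huv : u - v ∈ A.ker ⊓ (A ^ n).range :=
        ⟨mem_ker_iff.2 (by rw [map_sub, hAu, hAv, sub_self]),
          Submodule.sub_mem _ hu (range_pow_antitone A (le_max_left n k) hv)⟩
      rw [hn _ (le_max_left n k)] at huv
      have := Submodule.add_mem _ huv.2 hv
      rw [sub_add_cancel] at this
      exact range_pow_antitone A (le_max_right n k) this
    exact ⟨⟨u, huM⟩, Subtype.ext hAu⟩
  have hMu : IsUnit (A.restrict hM) := by
    obtain ⟨B, hB⟩ := exists_mul_eq_one_of_surjective hMs
    refine isUnit_of_mul_eq_one_of_frequently' hB (h.mono fun μ hμ => ?_)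
    refine isUnit_restrict_sub_smul hM hμ fun x hx => ?_
    rw [hMdef, Submodule.mem_iInf] at hx ⊢
    exact fun k => mem_range_pow_of_sub_smul hμ k (hx k)
  have hdis : ∀ x ∈ (A ^ n).range, A x = 0 → x = 0 := fun x hx hAx => by
    have hxM : x ∈ M := by
      rw [hMdef, Submodule.mem_iInf]
      intro k
      have hx' : x ∈ A.ker ⊓ (A ^ n).range := ⟨hAx, hx⟩
      rw [hn _ (le_max_left n k)] at hx'
      exact range_pow_antitone A (le_max_right n k) hx'.2
    have h0 : A.restrict hM ⟨x, hxM⟩ = A.restrict hM 0 := Subtype.ext (by simpa using hAx)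
    exact congrArg Subtype.val ((ContinuousLinearMap.isUnit_iff_bijective.1 hMu).1 h0)
  have hk : (A ^ n).ker = (A ^ (n + 1)).ker := by
    refine le_antisymm (ker_pow_monotone A (Nat.le_succ n)) fun x hx => ?_
    rw [mem_ker_iff, pow_succ_apply_left] at hx
    exact hdis _ ⟨x, rfl⟩ hx
  -- `A` restricts to a bijection of the range of `A ^ n`.
  have hr : (A ^ n).range = (A ^ (n + 1)).range := by
    have : CompleteSpace (A ^ n).range := (hclp n).completeSpace_coe
    have hR : ∀ x ∈ (A ^ n).range, A x ∈ (A ^ n).range := fun _ => map_mem_range_pow A n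
    have hRi : Function.Injective (A.restrict hR) := by
      rw [injective_iff_map_eq_zero]
      exact fun x hx => Subtype.ext (hdis x x.2 (congrArg Subtype.val hx))
    have hRc : IsClosed ((A.restrict hR).range : Set (A ^ n).range) := by
      convert (hclp (n + 1)).preimage continuous_subtype_val using 1
      ext x
      rw [← map_range_pow]
      constructor
      · rintro ⟨y, rfl⟩
        exact ⟨y, y.2, rfl⟩
      · rintro ⟨y, hy, hyx⟩
        exact ⟨⟨y, hy⟩, Subtype.ext hyx⟩
    obtain ⟨B, hB⟩ := exists_mul_eq_one_of_injective hRi hRc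
    have hRu : IsUnit (A.restrict hR) :=
      isUnit_of_mul_eq_one_of_frequently hB (h.mono fun μ hμ =>
        isUnit_restrict_sub_smul hR hμ fun x hx => mem_range_pow_of_sub_smul hμ n hx)
    refine le_antisymm (fun x hx => ?_) (range_pow_antitone A (Nat.le_succ n))
    obtain ⟨y, hy⟩ := (ContinuousLinearMap.isUnit_iff_bijective.1 hRu).2 ⟨x, hx⟩
    rw [← map_range_pow]
    exact ⟨y, y.2, congrArg Subtype.val hy⟩
  refine ⟨(isFredholm_iff A).2 ⟨⟨hfin, hcl⟩, ?_⟩, ascent_lt_top_iff.2 ⟨n, hk⟩,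
    descent_lt_top_iff.2 ⟨n, hr⟩⟩
  rwa [IsLowerSemiFredholm, ← nullity_eq_deficiency hk hr]

omit [CompleteSpace H] in
theorem IsBrowder.exists_stable_pow {A : H →L[ℂ] H} (h : IsBrowder A) :
    ∃ p, (A ^ p).ker = (A ^ (p + 1)).ker ∧ (A ^ p).range = (A ^ (p + 1)).range := by
  obtain ⟨m, hm⟩ := ascent_lt_top_iff.1 h.2.1
  obtain ⟨n, hn⟩ := descent_lt_top_iff.1 h.2.2
  exact ⟨m + n, exists_common_stable_pow hm hn⟩

theorem IsBrowder.index_eq_zero {A : H →L[ℂ] H} (h : IsBrowder A) : index A = 0 := by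
  obtain ⟨p, hk, hr⟩ := h.exists_stable_pow
  have hfin := ((isFredholm_iff A).1 h.1).1.1
  have := nullity_lt_top_iff.1 hfin
  rw [index, ← nullity_eq_deficiency hk hr]
  obtain ⟨k, hk⟩ := ENat.ne_top_iff_exists.1 hfin.ne
  rw [← hk]
  refine EReal.sub_self ?_ ?_
  · simp
  · simp

/-- In the Fitting decomposition, `A` is invertible on `(A ^ p).range` and nilpotent on `(A ^
p).ker`. The first part survives small `μ`, the second any `μ ≠ 0`. -/
theorem IsBrowder.eventually_isUnit_sub_smul {A : H →L[ℂ] H} (h : IsBrowder A) :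
    ∀ᶠ μ : ℂ in 𝓝[≠] 0, IsUnit (A - μ • 1) := by
  obtain ⟨p, hk, hr⟩ := h.exists_stable_pow
  obtain ⟨hfin, hcl⟩ := ((isFredholm_iff A).1 h.1).1
  have := nullity_lt_top_iff.1 hfin
  have : CompleteSpace (A ^ p).range := (isClosed_range_pow hcl p).completeSpace_coe
  have hR : ∀ x ∈ (A ^ p).range, A x ∈ (A ^ p).range := fun _ => map_mem_range_pow A p
  have hu : IsUnit (A.restrict hR) :=
    ContinuousLinearMap.isUnit_iff_bijective.2 (bijective_restrict_range_pow hk hr)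
  have hev : ∀ᶠ μ : ℂ in 𝓝 0, IsUnit (A.restrict hR - μ • 1) :=
    isUnit_sub_smul_eventually hu (1 : (A ^ p).range →L[ℂ] (A ^ p).range)
  filter_upwards [nhdsWithin_le_nhds hev, self_mem_nhdsWithin] with μ hμ hμ0
  rw [ContinuousLinearMap.isUnit_iff_bijective] at hμ ⊢
  constructor
  · rw [injective_iff_map_eq_zero]
    intro x hx
    have hAx : A x = μ • x := by simpa [sub_eq_zero] using hx
    have hpow : ∀ k : ℕ, (A ^ k) x = μ ^ k • x := fun k => by
      induction k with
      | zero => simp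
      | succ k ih => rw [pow_succ_apply_left, ih, map_smul, hAx, smul_smul, pow_succ]
    have hxR : x ∈ (A ^ p).range := by
      refine ⟨(μ ^ p)⁻¹ • x, ?_⟩
      change (A ^ p) _ = x
      rw [map_smul, hpow, smul_smul, inv_mul_cancel₀ (pow_ne_zero p hμ0), one_smul]
    have : (⟨x, hxR⟩ : (A ^ p).range) = 0 :=
      (injective_iff_map_eq_zero _).1 hμ.1 _ (Subtype.ext (by simpa using hx))
    exact congrArg Subtype.val this
  · have hrange : (A ^ p).range ≤ (A - μ • 1).range := fun x hx => by
      obtain ⟨y, hy⟩ := hμ.2 ⟨x, hx⟩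
      exact ⟨y, by simpa using congrArg Subtype.val hy⟩
    have hker : (A ^ p).ker ≤ (A - μ • 1).range := fun x hx => by
      rw [mem_ker_iff] at hx
      -- `A - μ • 1` divides `A ^ p - μ ^ p • 1`, which acts on `x` as `-μ ^ p`.
      have hcomm : Commute A (μ • (1 : H →L[ℂ] H)) := (Commute.one_right A).smul_right μ
      obtain ⟨q, hq⟩ := hcomm.sub_dvd_pow_sub_pow p
      have hqx := congrArg (fun f : H →L[ℂ] H => f x) hq
      have hqx' : -(μ ^ p • x) = (A - μ • 1) (q x) := by
        simpa [smul_pow, hx] using hqx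
      refine ⟨-((μ ^ p)⁻¹ • q x), ?_⟩
      change (A - μ • 1) _ = x
      rw [map_neg, map_smul, ← hqx', smul_neg, neg_neg, smul_smul,
        inv_mul_cancel₀ (pow_ne_zero p hμ0), one_smul]
    have htop : (A - μ • 1).range = ⊤ :=
      top_le_iff.1 ((isCompl_ker_range_pow hk hr).sup_eq_top ▸ sup_le hker hrange)
    exact LinearMap.range_eq_top.1 htop

/-! ### Consistency in invertibility and the pointwise comparison. -/

theorem IsBrowder.isCI {A : H →L[ℂ] H} (h : IsBrowder A) : IsCI A := by
  have key : IsUnit A → IsCI A := by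
    rintro ⟨u, rfl⟩ S
    rw [Units.isUnit_mul_units, Units.isUnit_units_mul]
  intro S
  constructor
  · intro hS
    have hi : Function.Injective A :=
      Function.Injective.of_comp (f := S) (ContinuousLinearMap.isUnit_iff_bijective.1 hS).1
    exact (key (ContinuousLinearMap.isUnit_iff_bijective.2
      ⟨hi, h.injective_iff_surjective.1 hi⟩) S).1 hS
  · intro hS
    have hs : Function.Surjective A :=
      Function.Surjective.of_comp (g := S) (ContinuousLinearMap.isUnit_iff_bijective.1 hS).2
    exact (key (ContinuousLinearMap.isUnit_iff_bijective.2
      ⟨h.injective_iff_surjective.2 hs, hs⟩) S).2 hS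

theorem IsCI.isUnit_of_isBoundedBelow {A : H →L[ℂ] H} (h : IsCI A) (hA : IsBoundedBelow A) :
    IsUnit A := by
  obtain ⟨hi, hc⟩ := isBoundedBelow_iff.1 hA
  obtain ⟨B, hB⟩ := exists_mul_eq_one_of_injective hi hc
  have hu : IsUnit (A * B) := (h B).1 (hB ▸ isUnit_one)
  exact ContinuousLinearMap.isUnit_iff_bijective.2 ⟨hi,
    Function.Surjective.of_comp (g := B) (ContinuousLinearMap.isUnit_iff_bijective.1 hu).2⟩

/-- Without injectivity no `S * A` is invertible, so CI can only fail through an invertible `A * S`.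
-/
theorem surjective_of_not_isCI {A : H →L[ℂ] H} (h : ¬ IsCI A) (hi : ¬ Function.Injective A) :
    Function.Surjective A := by
  simp only [IsCI, not_forall] at h
  obtain ⟨S, hS⟩ := h
  have h1 : ¬ IsUnit (S * A) := fun hu =>
    hi (Function.Injective.of_comp (f := S) (ContinuousLinearMap.isUnit_iff_bijective.1 hu).1)
  have h2 : IsUnit (A * S) := by tauto
  exact Function.Surjective.of_comp (g := S) (ContinuousLinearMap.isUnit_iff_bijective.1 h2).2

/-- At each point, membership in the two sides of property `(UW_E)` agrees exactly when membership
in the two sides of the decomposition of the Browder spectrum does. -/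
theorem mem_propertyUWE_iff_mem_browderSpectrum (T : H →L[ℂ] H) (μ : ℂ) :
    (μ ∈ approxSpectrum T \ essApproxSpectrum T ↔ μ ∈ isolatedEigenvalues T) ↔
      (μ ∈ browderSpectrum T ↔ μ ∈ ciSpectrum T ∪ piG T ∪
          (derivedSet (spectrum ℂ T) ∩ essApproxSpectrum T)) := by
  have hbb := isBoundedBelow_iff (A := T - μ • 1)
  have hacc := notMem_derivedSet_spectrum_iff (T := T) (μ := μ)
  have hea : μ ∈ essApproxSpectrum T ↔
      ¬ IsUpperSemiFredholm (T - μ • 1) ∨ 0 < index (T - μ • 1) := Iff.rfl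
  have hcl : μ ∉ essApproxSpectrum T → IsClosed ((T - μ • 1).range : Set H) := fun h => by
    rw [hea, not_or, not_not] at h
    exact h.1.2
  have hbr : IsBrowder (T - μ • 1) → IsCI (T - μ • 1) ∧
      IsClosed ((T - μ • 1).range : Set H) ∧ μ ∉ essApproxSpectrum T ∧
      μ ∉ derivedSet (spectrum ℂ T) := fun h => by
    refine ⟨h.isCI, h.1.isClosed_range, ?_, hacc.2 h.eventually_isUnit_sub_smul⟩
    rw [hea, h.index_eq_zero]
    simpa using ((isFredholm_iff _).1 h.1).1
  have hci : IsCI (T - μ • 1) → IsBoundedBelow (T - μ • 1) → IsUnit (T - μ • 1) :=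
    IsCI.isUnit_of_isBoundedBelow
  have hnci : ¬ IsCI (T - μ • 1) → ¬ Function.Injective (T - μ • 1 : H →L[ℂ] H) →
      μ ∈ derivedSet (spectrum ℂ T) ∧ μ ∈ essApproxSpectrum T := fun h hi => by
    have hs := surjective_of_not_isCI h hi
    refine ⟨by_contra fun hn => hi ?_, Or.inr (index_pos_of_surjective hs hi)⟩
    obtain ⟨B, hB⟩ := exists_mul_eq_one_of_surjective hs
    have hf : ∃ᶠ ν : ℂ in 𝓝 0, IsUnit (T - μ • 1 - ν • 1) :=
      (hacc.1 hn).frequently.filter_mono nhdsWithin_le_nhds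
    exact (ContinuousLinearMap.isUnit_iff_bijective.1
      (isUnit_of_mul_eq_one_of_frequently' hB hf)).1
  have hiso : μ ∉ essApproxSpectrum T → μ ∉ derivedSet (spectrum ℂ T) →
      IsBrowder (T - μ • 1) := fun h1 h2 => by
    rw [hea, not_or, not_not] at h1
    exact h1.1.isBrowder_of_frequently
      ((hacc.1 h2).frequently.filter_mono nhdsWithin_le_nhds)
  have hub : IsUnit (T - μ • 1) → IsBrowder (T - μ • 1) := isBrowder_of_isUnit
  have hui : IsUnit (T - μ • 1) → Function.Injective (T - μ • 1 : H →L[ℂ] H) := fun h =>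
    (ContinuousLinearMap.isUnit_iff_bijective.1 h).1
  have e1 : μ ∈ approxSpectrum T ↔ ¬ IsBoundedBelow (T - μ • 1) := Iff.rfl
  have e2 : μ ∈ browderSpectrum T ↔ ¬ IsBrowder (T - μ • 1) := Iff.rfl
  have e3 : μ ∈ ciSpectrum T ↔ ¬ IsCI (T - μ • 1) := Iff.rfl
  have e4 : μ ∈ goldbergSpectrum T ↔ ¬ IsClosed ((T - μ • 1).range : Set H) := Iff.rfl
  have e5 := mem_pointSpectrum_iff (T := T) (μ := μ)
  have e6 := mem_spectrum_iff (T := T) (μ := μ)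
  simp only [piG, isolatedEigenvalues, Set.mem_union, Set.mem_inter_iff, Set.mem_sdiff,
    e1, e2, e3, e4, e5, e6]
  clear hacc hea e1 e2 e3 e4 e5 e6
  generalize IsBoundedBelow (T - μ • 1) = a at *
  generalize (μ ∈ essApproxSpectrum T) = b at *
  generalize (μ ∈ derivedSet (spectrum ℂ T)) = c at *
  generalize IsCI (T - μ • 1) = d at *
  generalize IsBrowder (T - μ • 1) = e at *
  generalize IsUnit (T - μ • 1) = f at *
  generalize IsClosed ((T - μ • 1).range : Set H) = g at *
  generalize Function.Injective (T - μ • 1 : H →L[ℂ] H) = i at *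
  -- A Browder point satisfies both sides. At a non-Browder point, each side fails exactly when `i`
  -- is false and exactly one of `b`, `c` holds.
  grind

omit [CompleteSpace H] in
theorem piA_eq_piG (T : H →L[ℂ] H) : piA T = piG T := by
  ext μ
  have h1 : μ ∈ approxSpectrum T ↔ ¬ IsBoundedBelow (T - μ • 1) := Iff.rfl
  have h2 : μ ∈ goldbergSpectrum T ↔ ¬ IsClosed ((T - μ • 1).range : Set H) := Iff.rfl
  rw [piA, piG, Set.mem_sdiff, Set.mem_sdiff, mem_pointSpectrum_iff, h1, h2, isBoundedBelow_iff]
  tauto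

end Hilbert

end UWE

theorem proposition3p1 {H : Type*} [NormedAddCommGroup H] [InnerProductSpace ℂ H]
    [CompleteSpace H] [TopologicalSpace.SeparableSpace H] (hH : ¬ FiniteDimensional ℂ H)
    (T : H →L[ℂ] H) :
    (UWE.PropertyUWE T ↔
      UWE.browderSpectrum T =
        UWE.ciSpectrum T ∪ UWE.piG T ∪
          (derivedSet (spectrum ℂ T) ∩ UWE.essApproxSpectrum T)) ∧
    (UWE.PropertyUWE T ↔
      UWE.browderSpectrum T =
        UWE.ciSpectrum T ∪ UWE.piA T ∪
          (derivedSet (spectrum ℂ T) ∩ UWE.essApproxSpectrum T)) := by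
  rw [UWE.piA_eq_piG, and_self, UWE.PropertyUWE, Set.ext_iff, Set.ext_iff]
  exact forall_congr' (UWE.mem_propertyUWE_iff_mem_browderSpectrum T)
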